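/- Consider a finite-horizon two-player zero-sum partially observable stochastic game with finite sets of states $\mathcal S$, (non-empty) actions $\mathcal A^1,\mathcal A^2$ and observations $\mathcal Z^1,\mathcal Z^2$, transition probabilities $P^{z^1,z^2}_{a^1,a^2}(s'\mid s)$, reward $r(s,a^1,a^2)$, horizon $H\in\mathbb N$, discount factor $\gamma\in[0,1)$ and initial belief $b_0$; player 1 maximizes and player 2 minimizes the expected discounted sum of rewards. Let $\Theta^i_\tau=(\mathcal A^i\times\mathcal Z^i)^\tau$ be the set of player $i$'s private action-observation histories of length $\tau$. An occupancy state $o_\tau$ is a probability distribution on $\mathcal S\times\Theta^1_\tau\times\Theta^2_\tau$, and a decision rule $\beta^i_\tau$ of player $i$ maps each $\theta^i_\tau\in\Theta^i_\tau$ to a distribution $\beta^i_\tau(\theta^i_\tau,\cdot)$ on $\mathcal A^i$. Write $$T(o_\tau,\beta^1_\tau,\beta^2_\tau)\bigl(s',(\theta^1,a^1,z^1),(\theta^2,a^2,z^2)\bigr)=\beta^1_\tau(\theta^1,a^1)\,\beta^2_\tau(\theta^2,a^2)\sum_{s}P^{z^1,z^2}_{a^1,a^2}(s'\mid s)\,o_\tau(s,\theta^1,\theta^2)$$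 for the next occupancy state, and $$r(o_\tau,\beta^1_\tau,\beta^2_\tau)=\sum_{s,\theta^1,\theta^2}o_\tau(s,\theta^1,\theta^2)\sum_{a^1,a^2}\beta^1_\tau(\theta^1,a^1)\,\beta^2_\tau(\theta^2,a^2)\,r(s,a^1,a^2)$$ for the expected instant reward. The subgame at $o_t$ has payoff $$V_t(o_t,\beta^1_{t:H-1},\beta^2_{t:H-1})=\mathbb E\Bigl[\sum_{t'=t}^{H-1}\gamma^{t'-t}R_{t'}\,\Big|\,O_t=o_t,\ \beta^1_{t:H-1},\ \beta^2_{t:H-1}\Bigr],$$ where the players choose behavioral strategies $\beta^i_{t:H-1}=(\beta^i_t,\dots,\beta^i_{H-1})$ and $R_{t'}$ is the instant reward at time $t'$ (the sum is $0$ if $t=H$). Let $V^*_t(o_t)$ be its Nash equilibrium value. For $\tau\in\{0,\dots,H-1\}$ and any occupancy state $o_\tau$, the local game at $o_\tau$ is the zero-sum game in which the players choose decision rules $\beta^1_\tau,\beta^2_\tau$ and the payoff to player 1 is $$Q^*_\tau(o_\tau,\beta^1_\tau,\beta^2_\tau)=r(o_\tau,\beta^1_\tau,\beta^2_\tau)+\gamma\,V^*_{\tau+1}\bigl(T(o_\tau,\beta^1_\tau,\beta^2_\tau)\bigr).$$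 **Theorem.** This game is well defined: every subgame at time $\tau+1$ has a Nash equilibrium in behavioral strategies, and all its Nash equilibria have the same value $V^*_{\tau+1}$. As in two-player zero-sum normal-form games: 1. the local game $Q^*_\tau(o_\tau,\cdot,\cdot)$ has at least one Nash equilibrium; 2. all Nash equilibria of $Q^*_\tau(o_\tau,\cdot,\cdot)$ have the same value; 3. the problems $\max_{\beta^1_\tau}\min_{\beta^2_\tau}Q^*_\tau(o_\tau,\beta^1_\tau,\beta^2_\tau)$ and $\min_{\beta^2_\tau}\max_{\beta^1_\tau}Q^*_\tau(o_\tau,\beta^1_\tau,\beta^2_\tau)$ have solutions (all maxima and minima are attained), and whenever $\beta^{1*}_\tau$ solves the first and $\beta^{2*}_\tau$ solves the second, the two optimal values coincide, $(\beta^{1*}_\tau,\beta^{2*}_\tau)$ is a Nash equilibrium of $Q^*_\tau(o_\tau,\cdot,\cdot)$, and $Q^*_\tau(o_\tau,\beta^{1*}_\tau,\beta^{2*}_\tau)$ is that common value. -/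

import Mathlib

/-! ### Two-player zero-sum games given by a payoff function

Player 1 chooses `x : X` and maximizes `u x y`; player 2 chooses `y : Y` and minimizes `u x y`. -/

/-- `(x, y)` is a Nash equilibrium: no player gains by a unilateral deviation. -/
def IsNash {X Y : Type*} (u : X → Y → ℝ) (x : X) (y : Y) : Prop :=
  (∀ x', u x' y ≤ u x y) ∧ (∀ y', u x y ≤ u x y')

theorem IsNash.value_unique {X Y : Type*} {u : X → Y → ℝ} {x x' : X} {y y' : Y}
    (h : IsNash u x y) (h' : IsNash u x' y') : u x y = u x' y' :=
  le_antisymm ((h.2 y').trans (h'.1 x)) ((h'.2 y).trans (h.1 x'))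

open Classical in
/-- The Nash equilibrium value of a game: the payoff at an equilibrium (all equilibria have the
same payoff, see `IsNash.nashValue_eq`; the value `0` is used if there is none). -/
noncomputable def nashValue {X Y : Type*} (u : X → Y → ℝ) : ℝ :=
  if h : ∃ p : X × Y, IsNash u p.1 p.2 then u h.choose.1 h.choose.2 else 0

theorem IsNash.nashValue_eq {X Y : Type*} {u : X → Y → ℝ} {x : X} {y : Y}
    (h : IsNash u x y) : nashValue u = u x y := by
  have hex : ∃ p : X × Y, IsNash u p.1 p.2 := ⟨(x, y), h⟩
  unfold nashValue
  rw [dif_pos hex]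
  exact hex.choose_spec.value_unique h

/-- `x` solves `max_x min_y u x y` and `v` is that maximin value: all the inner minima exist
(`m x'` is the minimum of `u x'`), `v` is the largest of them, and `x` attains it. -/
def SolvesMaximin {X Y : Type*} (u : X → Y → ℝ) (x : X) (v : ℝ) : Prop :=
  ∃ m : X → ℝ, (∀ x', IsLeast (Set.range (u x')) (m x')) ∧
    IsGreatest (Set.range m) v ∧ m x = v

/-- `y` solves `min_y max_x u x y` and `v` is that minimax value. -/
def SolvesMinimax {X Y : Type*} (u : X → Y → ℝ) (y : Y) (v : ℝ) : Prop :=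
  ∃ m : Y → ℝ, (∀ y', IsGreatest (Set.range fun x => u x y') (m y')) ∧
    IsLeast (Set.range m) v ∧ m y = v

/-! ### Zero-sum partially observable stochastic games -/

/-- A finite-horizon two-player zero-sum partially observable stochastic game. Probability
distributions on a finite type are points of its standard simplex. -/
structure ZSPOSG (S A₁ A₂ Z₁ Z₂ : Type*) [Fintype S] [Fintype Z₁] [Fintype Z₂] where
  /-- `trans s a₁ a₂ (s', z₁, z₂)` is the probability to move from `s` to `s'` and to receive the
  observations `z₁`, `z₂` when the actions `a₁`, `a₂` are performed. -/
  trans : S → A₁ → A₂ → stdSimplex ℝ (S × Z₁ × Z₂)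
  reward : S → A₁ → A₂ → ℝ
  horizon : ℕ
  discount : ℝ
  discount_nonneg : 0 ≤ discount
  discount_lt_one : discount < 1
  initialBelief : stdSimplex ℝ S

/-- Private action-observation histories of length `t`. -/
abbrev Hist (A Z : Type*) (t : ℕ) : Type _ := Fin t → A × Z

/-- Behavioral decision rules at time `t`: maps from private histories of length `t` to
distributions over private actions. -/
abbrev DecisionRule (A Z : Type*) [Fintype A] (t : ℕ) : Type _ := Hist A Z t → stdSimplex ℝ A

/-- Behavioral strategies, one decision rule for each time step. In a subgame that starts at time
`t` with horizon `H`, only the decision rules at times `t, …, H - 1` have any effect. -/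
abbrev Strategy (A Z : Type*) [Fintype A] : Type _ := ∀ t : ℕ, DecisionRule A Z t

/-- Occupancy states at time `t`: distributions over state--joint-history pairs. -/
abbrev Occupancy (S A₁ A₂ Z₁ Z₂ : Type*) [Fintype S] [Fintype A₁] [Fintype A₂] [Fintype Z₁]
    [Fintype Z₂] (t : ℕ) : Type _ :=
  stdSimplex ℝ (S × Hist A₁ Z₁ t × Hist A₂ Z₂ t)

namespace ZSPOSG

section

variable {S A₁ A₂ Z₁ Z₂ : Type*} [Fintype S] [Fintype A₁] [Fintype A₂] [Fintype Z₁] [Fintype Z₂]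
  (G : ZSPOSG S A₁ A₂ Z₁ Z₂)

/-- The probability of `(s', θ₁', θ₂')` at time `t + 1`, where `θᵢ'` extends the history
`Fin.init θᵢ'` of length `t` by its last action-observation pair. -/
def nextFun {t : ℕ} (o : Occupancy S A₁ A₂ Z₁ Z₂ t) (β₁ : DecisionRule A₁ Z₁ t)
    (β₂ : DecisionRule A₂ Z₂ t) (x : S × Hist A₁ Z₁ (t + 1) × Hist A₂ Z₂ (t + 1)) : ℝ :=
  (β₁ (Fin.init x.2.1)).1 (x.2.1 (Fin.last t)).1 *
    (β₂ (Fin.init x.2.2)).1 (x.2.2 (Fin.last t)).1 *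
      ∑ s : S, (G.trans s (x.2.1 (Fin.last t)).1 (x.2.2 (Fin.last t)).1).1
          (x.1, (x.2.1 (Fin.last t)).2, (x.2.2 (Fin.last t)).2) *
        o.1 (s, Fin.init x.2.1, Fin.init x.2.2)

theorem nextFun_snoc {t : ℕ} (o : Occupancy S A₁ A₂ Z₁ Z₂ t) (β₁ : DecisionRule A₁ Z₁ t)
    (β₂ : DecisionRule A₂ Z₂ t) (s' : S) (θ₁ : Hist A₁ Z₁ t) (a₁ : A₁) (z₁ : Z₁)
    (θ₂ : Hist A₂ Z₂ t) (a₂ : A₂) (z₂ : Z₂) :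
    G.nextFun o β₁ β₂ (s', (Fin.snoc θ₁ (a₁, z₁) : Hist A₁ Z₁ (t + 1)),
        (Fin.snoc θ₂ (a₂, z₂) : Hist A₂ Z₂ (t + 1))) =
      (β₁ θ₁).1 a₁ * (β₂ θ₂).1 a₂ *
        ∑ s : S, (G.trans s a₁ a₂).1 (s', z₁, z₂) * o.1 (s, θ₁, θ₂) := by
  simp only [nextFun, Fin.init_snoc, Fin.snoc_last]

theorem sum_hist_succ {A Z : Type*} [Fintype A] [Fintype Z] {t : ℕ} (f : Hist A Z (t + 1) → ℝ) :
    ∑ θ', f θ' = ∑ θ : Hist A Z t, ∑ a : A, ∑ z : Z, f (Fin.snoc θ (a, z)) := by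
  rw [← (Fin.snocEquiv (fun _ : Fin (t + 1) => A × Z)).sum_comp f, Fintype.sum_prod_type_right]
  refine Finset.sum_congr rfl fun θ _ => ?_
  rw [Fintype.sum_prod_type]
  rfl

theorem nextFun_mem {t : ℕ} (o : Occupancy S A₁ A₂ Z₁ Z₂ t) (β₁ : DecisionRule A₁ Z₁ t)
    (β₂ : DecisionRule A₂ Z₂ t) :
    G.nextFun o β₁ β₂ ∈ stdSimplex ℝ (S × Hist A₁ Z₁ (t + 1) × Hist A₂ Z₂ (t + 1)) := by
  constructor
  · intro x
    exact mul_nonneg (mul_nonneg ((β₁ _).2.1 _) ((β₂ _).2.1 _))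
      (Finset.sum_nonneg fun s _ => mul_nonneg ((G.trans s _ _).2.1 _) (o.2.1 _))
  · have htrans : ∀ s a₁ a₂, ∑ z₁, ∑ z₂, ∑ s', (G.trans s a₁ a₂).1 (s', z₁, z₂) = 1 := by
      intro s a₁ a₂
      have h := (G.trans s a₁ a₂).2.2
      rw [Fintype.sum_prod_type_right, Fintype.sum_prod_type] at h
      exact h
    have key : ∀ (θ₁ : Hist A₁ Z₁ t) (θ₂ : Hist A₂ Z₂ t) (a₁ : A₁) (a₂ : A₂),
        (∑ z₁, ∑ z₂, ∑ s', (β₁ θ₁).1 a₁ * (β₂ θ₂).1 a₂ *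
          ∑ s : S, (G.trans s a₁ a₂).1 (s', z₁, z₂) * o.1 (s, θ₁, θ₂)) =
        (β₁ θ₁).1 a₁ * ((β₂ θ₂).1 a₂ * ∑ s, o.1 (s, θ₁, θ₂)) := by
      intro θ₁ θ₂ a₁ a₂
      simp only [← Finset.mul_sum]
      rw [mul_assoc]
      congr 2
      calc (∑ z₁, ∑ z₂, ∑ s', ∑ s, (G.trans s a₁ a₂).1 (s', z₁, z₂) * o.1 (s, θ₁, θ₂))
          = ∑ z₁, ∑ z₂, ∑ s, ∑ s', (G.trans s a₁ a₂).1 (s', z₁, z₂) * o.1 (s, θ₁, θ₂) :=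
            Finset.sum_congr rfl fun _ _ => Finset.sum_congr rfl fun _ _ => Finset.sum_comm
        _ = ∑ z₁, ∑ s, ∑ z₂, ∑ s', (G.trans s a₁ a₂).1 (s', z₁, z₂) * o.1 (s, θ₁, θ₂) :=
            Finset.sum_congr rfl fun _ _ => Finset.sum_comm
        _ = ∑ s, ∑ z₁, ∑ z₂, ∑ s', (G.trans s a₁ a₂).1 (s', z₁, z₂) * o.1 (s, θ₁, θ₂) :=
            Finset.sum_comm
        _ = ∑ s, o.1 (s, θ₁, θ₂) := by
            simp only [← Finset.sum_mul, htrans, one_mul]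
    have ho := o.2.2
    rw [Fintype.sum_prod_type_right, Fintype.sum_prod_type] at ho ⊢
    rw [sum_hist_succ, ← ho]
    refine Finset.sum_congr rfl fun θ₁ _ => ?_
    simp only [sum_hist_succ, nextFun_snoc]
    calc (∑ a₁, ∑ z₁, ∑ θ₂, ∑ a₂, ∑ z₂, ∑ s', (β₁ θ₁).1 a₁ * (β₂ θ₂).1 a₂ *
          ∑ s : S, (G.trans s a₁ a₂).1 (s', z₁, z₂) * o.1 (s, θ₁, θ₂))
        = ∑ a₁, ∑ θ₂, ∑ z₁, ∑ a₂, ∑ z₂, ∑ s', (β₁ θ₁).1 a₁ * (β₂ θ₂).1 a₂ *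
          ∑ s : S, (G.trans s a₁ a₂).1 (s', z₁, z₂) * o.1 (s, θ₁, θ₂) :=
          Finset.sum_congr rfl fun _ _ => Finset.sum_comm
      _ = ∑ a₁, ∑ θ₂, ∑ a₂, ∑ z₁, ∑ z₂, ∑ s', (β₁ θ₁).1 a₁ * (β₂ θ₂).1 a₂ *
          ∑ s : S, (G.trans s a₁ a₂).1 (s', z₁, z₂) * o.1 (s, θ₁, θ₂) :=
          Finset.sum_congr rfl fun _ _ => Finset.sum_congr rfl fun _ _ => Finset.sum_comm
      _ = ∑ a₁, (β₁ θ₁).1 a₁ * ∑ θ₂, ∑ s, o.1 (s, θ₁, θ₂) := by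
          simp only [key]
          simp only [← Finset.mul_sum, ← Finset.sum_mul, (β₂ _).2.2, one_mul]
      _ = ∑ θ₂, ∑ s, o.1 (s, θ₁, θ₂) := by
          rw [← Finset.sum_mul, (β₁ θ₁).2.2, one_mul]

/-- The deterministic transition function on occupancy states: the law of the state and the joint
history at time `t + 1`, when they have law `o` at time `t` and `β₁`, `β₂` are applied. -/
def next {t : ℕ} (o : Occupancy S A₁ A₂ Z₁ Z₂ t) (β₁ : DecisionRule A₁ Z₁ t)
    (β₂ : DecisionRule A₂ Z₂ t) : Occupancy S A₁ A₂ Z₁ Z₂ (t + 1) :=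
  ⟨G.nextFun o β₁ β₂, G.nextFun_mem o β₁ β₂⟩

/-- The expected instant reward `r(o, β₁, β₂) = E[r(S, A¹, A²) | o, β₁, β₂]`. -/
def occReward {t : ℕ} (o : Occupancy S A₁ A₂ Z₁ Z₂ t) (β₁ : DecisionRule A₁ Z₁ t)
    (β₂ : DecisionRule A₂ Z₂ t) : ℝ :=
  ∑ s : S, ∑ θ₁ : Hist A₁ Z₁ t, ∑ θ₂ : Hist A₂ Z₂ t, o.1 (s, θ₁, θ₂) *
    ∑ a₁ : A₁, ∑ a₂ : A₂, (β₁ θ₁).1 a₁ * (β₂ θ₂).1 a₂ * G.reward s a₁ a₂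

/-- `expReward k t o σ₁ σ₂` is `E[R_{t+k} | O_t = o, σ₁, σ₂]`: the expected instant reward after the
occupancy state has been moved forward `k` times from time `t`. -/
def expReward : ℕ → (t : ℕ) → Occupancy S A₁ A₂ Z₁ Z₂ t → Strategy A₁ Z₁ →
    Strategy A₂ Z₂ → ℝ
  | 0, t, o, σ₁, σ₂ => G.occReward o (σ₁ t) (σ₂ t)
  | k + 1, t, o, σ₁, σ₂ => expReward k (t + 1) (G.next o (σ₁ t) (σ₂ t)) σ₁ σ₂

/-- The value `V_t(o, σ₁, σ₂) = E[∑_{t ≤ t' < H} γ^(t'-t) R_{t'} | O_t = o, σ₁, σ₂]` of a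
behavioral strategy profile in the subgame at `o`, for `t ≤ H`. -/
def value (t : ℕ) (o : Occupancy S A₁ A₂ Z₁ Z₂ t) (σ₁ : Strategy A₁ Z₁) (σ₂ : Strategy A₂ Z₂) : ℝ :=
  ∑ k ∈ Finset.range (G.horizon - t), G.discount ^ k * G.expReward k t o σ₁ σ₂

/-- `V*_t(o)`, the Nash equilibrium value of the subgame at `o`. -/
noncomputable def optValue (t : ℕ) (o : Occupancy S A₁ A₂ Z₁ Z₂ t) : ℝ :=
  nashValue (G.value t o)

/-- The local game `Q*_t(o, β₁, β₂) = r(o, β₁, β₂) + γ V*_{t+1}(T(o, β₁, β₂))`, whose players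
choose decision rules at time `t`. -/
noncomputable def localGame {t : ℕ} (o : Occupancy S A₁ A₂ Z₁ Z₂ t) (β₁ : DecisionRule A₁ Z₁ t)
    (β₂ : DecisionRule A₂ Z₂ t) : ℝ :=
  G.occReward o β₁ β₂ + G.discount * G.optValue (t + 1) (G.next o β₁ β₂)

end

end ZSPOSG

/-! ### Zero-sum games in normal form -/

/-! The local game contains the value function of the next subgame, and no concave-convex structure
of it in the decision rules is used. Its equilibrium comes instead from the whole subgame at `o`,
whose equilibrium `(σ₁, σ₂)` is restricted to its first decision rules. If player 1 deviates to `β₁`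
in the local game, he is credited with the value of the subgame that is reached; in the whole
subgame he secures at least as much against `σ₂` by playing `β₁` and then an equilibrium strategy of
the subgame reached, so the deviation cannot pay (`isNash_localGame`). Player 2 is symmetric.

Subgames have equilibria because behavioral strategies can be replaced by realization plans, the
products of a player's own action probabilities along a history. They form a compact convex set on
which the payoff is bilinear, so Sion's theorem gives a saddle point, and normalization turns it
back into strategies (`exists_isNash_value`).

The value is then a max-min of a jointly continuous payoff over compact sets, hence continuous in
the occupancy state. So the local game is continuous on compact spaces and its inner optima are
attained. The remaining claims hold in any zero-sum game with an equilibrium. -/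

theorem IsNash.solvesMaximin {X Y : Type*} {u : X → Y → ℝ} {x : X} {y : Y} (h : IsNash u x y)
    (hmin : ∀ x', ∃ m, IsLeast (Set.range (u x')) m) : SolvesMaximin u x (u x y) := by
  choose m hm using hmin
  have hx : m x = u x y :=
    (hm x).unique ⟨⟨y, rfl⟩, Set.forall_mem_range.2 h.2⟩
  refine ⟨m, hm, ⟨⟨x, hx⟩, ?_⟩, hx⟩
  rintro _ ⟨x', rfl⟩
  exact ((hm x').2 ⟨y, rfl⟩).trans (h.1 x')

theorem IsNash.solvesMinimax {X Y : Type*} {u : X → Y → ℝ} {x : X} {y : Y} (h : IsNash u x y)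
    (hmax : ∀ y', ∃ m, IsGreatest (Set.range fun x' => u x' y') m) :
    SolvesMinimax u y (u x y) := by
  choose m hm using hmax
  have hy : m y = u x y :=
    (hm y).unique ⟨⟨x, rfl⟩, Set.forall_mem_range.2 h.1⟩
  refine ⟨m, hm, ⟨⟨y, hy⟩, ?_⟩, hy⟩
  rintro _ ⟨y', rfl⟩
  exact (h.2 y').trans ((hm y').2 ⟨x, rfl⟩)

/-- The inner minima are unique, so the function `m` is the same for every solution; the equilibrium
strategy `x₀` is one of the solutions. -/
theorem SolvesMaximin.value_eq {X Y : Type*} {u : X → Y → ℝ} {x x₀ : X} {y₀ : Y} {v : ℝ}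
    (h : SolvesMaximin u x v) (h₀ : IsNash u x₀ y₀) : v = u x₀ y₀ := by
  obtain ⟨m, hm, hv, -⟩ := h
  obtain ⟨m', hm', hv', -⟩ := h₀.solvesMaximin fun x' => ⟨m x', hm x'⟩
  have : m = m' := funext fun x' => (hm x').unique (hm' x')
  exact hv.unique (this ▸ hv')

theorem SolvesMinimax.value_eq {X Y : Type*} {u : X → Y → ℝ} {x₀ : X} {y y₀ : Y} {w : ℝ}
    (h : SolvesMinimax u y w) (h₀ : IsNash u x₀ y₀) : w = u x₀ y₀ := by
  obtain ⟨m, hm, hw, -⟩ := h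
  obtain ⟨m', hm', hw', -⟩ := h₀.solvesMinimax fun y' => ⟨m y', hm y'⟩
  have : m = m' := funext fun y' => (hm y').unique (hm' y')
  exact hw.unique (this ▸ hw')

/-- In a game with an equilibrium, maximin and minimax solutions form an equilibrium. -/
theorem SolvesMaximin.isNash {X Y : Type*} {u : X → Y → ℝ} {x x₀ : X} {y y₀ : Y} {v w : ℝ}
    (hx : SolvesMaximin u x v) (hy : SolvesMinimax u y w) (h₀ : IsNash u x₀ y₀) :
    v = w ∧ IsNash u x y ∧ u x y = v := by
  have hvw : v = w := (hx.value_eq h₀).trans (hy.value_eq h₀).symm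
  obtain ⟨m, hm, -, rfl⟩ := hx
  obtain ⟨m', hm', -, rfl⟩ := hy
  have h₁ : ∀ y', m x ≤ u x y' := fun y' => (hm x).2 ⟨y', rfl⟩
  have h₂ : ∀ x', u x' y ≤ m' y := fun x' => (hm' y).2 ⟨x', rfl⟩
  -- The payoff is squeezed between the guarantees of the two players, which coincide.
  have hxy : u x y = m x := le_antisymm ((h₂ x).trans hvw.ge) (h₁ y)
  exact ⟨hvw, ⟨fun x' => (h₂ x').trans (hvw.ge.trans hxy.ge), fun y' => hxy.le.trans (h₁ y')⟩, hxy⟩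

/-- The equilibrium value of a family of games on compact strategy spaces depends continuously on
the parameter. -/
theorem continuous_nashValue {P X Y : Type*} [TopologicalSpace P] [TopologicalSpace X]
    [TopologicalSpace Y] [CompactSpace X] [CompactSpace Y] {u : P → X → Y → ℝ}
    (hu : Continuous fun q : P × X × Y => u q.1 q.2.1 q.2.2)
    (hex : ∀ p, ∃ x y, IsNash (u p) x y) : Continuous fun p => nashValue (u p) := by
  -- Equilibria may jump with the parameter, but the value is a max-min, and extrema over a compact
  -- space preserve continuity.
  have hinf : Continuous fun q : P × X => sInf ((fun y => u q.1 q.2 y) '' Set.univ) := by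
    apply isCompact_univ.continuous_sInf
    exact hu.comp (f := fun q : (P × X) × Y => (q.1.1, q.1.2, q.2)) (by fun_prop)
  have hsup : Continuous fun p =>
      sSup ((fun x => sInf ((fun y => u p x y) '' Set.univ)) '' Set.univ) := by
    apply isCompact_univ.continuous_sSup
    exact hinf
  convert hsup using 2 with p
  obtain ⟨x, y, h⟩ := hex p
  have hmin : ∀ x', IsLeast ((fun y => u p x' y) '' Set.univ)
      (sInf ((fun y => u p x' y) '' Set.univ)) := fun x' =>
    (isCompact_univ.image (hu.comp (f := fun y' : Y => (p, x', y')) (by fun_prop))).isLeast_sInf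
      ⟨_, y, trivial, rfl⟩
  rw [h.nashValue_eq]
  have hx : sInf ((fun y => u p x y) '' Set.univ) = u p x y := by
    refine (hmin x).unique ⟨⟨y, trivial, rfl⟩, ?_⟩
    rintro _ ⟨y', -, rfl⟩
    exact h.2 y'
  have hg : IsGreatest ((fun x => sInf ((fun y => u p x y) '' Set.univ)) '' Set.univ)
      (u p x y) := by
    refine ⟨⟨x, trivial, hx⟩, ?_⟩
    rintro _ ⟨x', -, rfl⟩
    exact ((hmin x').2 ⟨y, trivial, rfl⟩).trans (h.1 x')
  exact hg.csSup_eq.symm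

/-! ### Realization plans -/

theorem Continuous.stdSimplex_apply {X ι : Type*} [TopologicalSpace X] [Fintype ι]
    {f : X → stdSimplex ℝ ι} (hf : Continuous f) (i : ι) : Continuous fun x => (f x).1 i :=
  (continuous_apply i).comp (continuous_subtype_val.comp hf)

section RealizationPlans

variable {A Z : Type*} [Fintype A]

/-- The product of the probabilities that the player assigns to her own actions along a history,
from time `t` on. -/
def reachWeight (t : ℕ) (σ : Strategy A Z) : ∀ n : ℕ, Hist A Z n → ℝ
  | 0, _ => 1
  -- Actions before time `t` are already accounted for in the occupancy state; the first factor to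
  -- count is that of the rule at time `t`, for histories of length `t + 1`.
  | n + 1, θ => if n + 1 ≤ t then 1 else
      reachWeight t σ n (Fin.init θ) * (σ n (Fin.init θ)).1 (θ (Fin.last n)).1

theorem reachWeight_of_le (t : ℕ) (σ : Strategy A Z) {n : ℕ} (hn : n ≤ t) (θ : Hist A Z n) :
    reachWeight t σ n θ = 1 := by
  cases n with
  | zero => rfl
  | succ n => rw [reachWeight, if_pos hn]

theorem reachWeight_succ (t : ℕ) (σ : Strategy A Z) {n : ℕ} (hn : t ≤ n) (θ : Hist A Z (n + 1)) :
    reachWeight t σ (n + 1) θ =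
      reachWeight t σ n (Fin.init θ) * (σ n (Fin.init θ)).1 (θ (Fin.last n)).1 := by
  rw [reachWeight, if_neg (by omega)]

theorem reachWeight_nonneg (t : ℕ) (σ : Strategy A Z) (n : ℕ) (θ : Hist A Z n) :
    0 ≤ reachWeight t σ n θ := by
  induction n with
  | zero => exact zero_le_one
  | succ n ih =>
    rw [reachWeight]
    split_ifs
    · exact zero_le_one
    · exact mul_nonneg (ih _) ((σ n _).2.1 _)

theorem continuous_reachWeight (t n : ℕ) (θ : Hist A Z n) :
    Continuous fun σ : Strategy A Z => reachWeight t σ n θ := by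
  induction n with
  | zero => exact continuous_const
  | succ n ih =>
    simp only [reachWeight]
    split_ifs
    · exact continuous_const
    · have hσ : Continuous fun σ : Strategy A Z => σ n (Fin.init θ) := by fun_prop
      exact (ih (Fin.init θ)).mul (hσ.stdSimplex_apply _)

/-- The realization plan of a behavioral strategy in a subgame that starts at time `t`. -/
def realizationPlan (t : ℕ) (σ : Strategy A Z) (n : ℕ) (θ : Hist A Z n) (a : A) : ℝ :=
  reachWeight t σ n θ * (σ n θ).1 a

variable (A Z) in
/-- The realization plans in a subgame that starts at time `t`, given by their linear
constraints. -/
def realizationPlans (t : ℕ) : Set (∀ n, Hist A Z n → A → ℝ) :=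
  -- Coordinates before `t` do not affect the payoff; constraining them too makes this set exactly
  -- the image of the strategy space.
  {x | (∀ n θ a, 0 ≤ x n θ a) ∧ (∀ n ≤ t, ∀ θ, ∑ a, x n θ a = 1) ∧
    ∀ n, t ≤ n → ∀ θ : Hist A Z (n + 1),
      ∑ a, x (n + 1) θ a = x n (Fin.init θ) (θ (Fin.last n)).1}

theorem sum_realizationPlan (t : ℕ) (σ : Strategy A Z) (n : ℕ) (θ : Hist A Z n) :
    ∑ a, realizationPlan t σ n θ a = reachWeight t σ n θ := by
  simp only [realizationPlan, ← Finset.mul_sum, (σ n θ).2.2, mul_one]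

theorem realizationPlan_mem (t : ℕ) (σ : Strategy A Z) :
    realizationPlan t σ ∈ realizationPlans A Z t := by
  refine ⟨fun n θ a => mul_nonneg (reachWeight_nonneg t σ n θ) ((σ n θ).2.1 a), ?_, ?_⟩
  · intro n hn θ
    rw [sum_realizationPlan, reachWeight_of_le t σ hn]
  · intro n hn θ
    rw [sum_realizationPlan, reachWeight_succ t σ hn, realizationPlan]

/-- Every realization plan is induced by a behavioral strategy, obtained by normalization. -/
theorem exists_realizationPlan_eq [Nonempty A] {t : ℕ} {x : ∀ n, Hist A Z n → A → ℝ}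
    (hx : x ∈ realizationPlans A Z t) : ∃ σ : Strategy A Z, realizationPlan t σ = x := by
  obtain ⟨h0, h1, h2⟩ := hx
  have hσ : ∀ n (θ : Hist A Z n), ∃ p : stdSimplex ℝ A,
      ∀ a, (∑ b, x n θ b) * p.1 a = x n θ a := by
    intro n θ
    -- At a history of total weight zero all entries vanish, so any distribution serves.
    by_cases hs : ∑ b, x n θ b = 0
    · obtain ⟨p⟩ : Nonempty (stdSimplex ℝ A) := inferInstance
      refine ⟨p, fun a => ?_⟩
      rw [hs, zero_mul, (Finset.sum_eq_zero_iff_of_nonneg fun b _ => h0 n θ b).1 hs a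
        (Finset.mem_univ a)]
    · refine ⟨⟨fun a => x n θ a / ∑ b, x n θ b, fun a =>
        div_nonneg (h0 n θ a) (Finset.sum_nonneg fun b _ => h0 n θ b), ?_⟩, fun a => ?_⟩
      · rw [← Finset.sum_div, div_self hs]
      · exact mul_div_cancel₀ _ hs
  choose σ hσ using hσ
  have hreach : ∀ n (θ : Hist A Z n), reachWeight t σ n θ = ∑ a, x n θ a := by
    intro n
    induction n with
    | zero => intro θ; rw [h1 0 (Nat.zero_le t)]; rfl
    | succ n ih =>
      intro θ
      rcases Nat.lt_or_ge n t with hn | hn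
      · rw [reachWeight_of_le t σ hn, h1 _ hn]
      · rw [reachWeight_succ t σ hn, ih, hσ, h2 n hn]
  refine ⟨σ, ?_⟩
  ext n θ a
  rw [realizationPlan, hreach, hσ]

theorem range_realizationPlan [Nonempty A] (t : ℕ) :
    Set.range (realizationPlan (A := A) (Z := Z) t) = realizationPlans A Z t :=
  Set.Subset.antisymm (Set.range_subset_iff.2 (realizationPlan_mem t))
    fun _ hx => exists_realizationPlan_eq hx

theorem convex_realizationPlans (t : ℕ) : Convex ℝ (realizationPlans A Z t) := by
  rintro x ⟨hx0, hx1, hx2⟩ y ⟨hy0, hy1, hy2⟩ a b ha hb hab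
  refine ⟨fun n θ c => ?_, fun n hn θ => ?_, fun n hn θ => ?_⟩
  · exact add_nonneg (mul_nonneg ha (hx0 n θ c)) (mul_nonneg hb (hy0 n θ c))
  · simp only [Pi.add_apply, Pi.smul_apply, smul_eq_mul, Finset.sum_add_distrib, ← Finset.mul_sum,
      hx1 n hn, hy1 n hn, mul_one, hab]
  · simp only [Pi.add_apply, Pi.smul_apply, smul_eq_mul, Finset.sum_add_distrib, ← Finset.mul_sum,
      hx2 n hn, hy2 n hn]

/-- A continuous image of the strategy space, which is compact as a product of simplices. -/
theorem isCompact_realizationPlans [Nonempty A] (t : ℕ) :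
    IsCompact (realizationPlans A Z t) := by
  rw [← range_realizationPlan]
  refine isCompact_range ?_
  refine continuous_pi fun n => continuous_pi fun θ => continuous_pi fun a => ?_
  have hσ : Continuous fun σ : Strategy A Z => σ n θ := by fun_prop
  exact (continuous_reachWeight t n θ).mul (hσ.stdSimplex_apply a)

theorem realizationPlans_nonempty [Nonempty A] (t : ℕ) : (realizationPlans A Z t).Nonempty := by
  rw [← range_realizationPlan]
  exact Set.range_nonempty _

end RealizationPlans

namespace ZSPOSG

variable {S A₁ A₂ Z₁ Z₂ : Type*} [Fintype S] [Fintype A₁] [Fintype A₂] [Fintype Z₁] [Fintype Z₂]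
  (G : ZSPOSG S A₁ A₂ Z₁ Z₂)

/-! ### The payoff of realization plans -/

/-- The transition of weights on states and joint histories with the factors contributed by the
players' decision rules left out. -/
def chanceStep {t : ℕ} (f : S × Hist A₁ Z₁ t × Hist A₂ Z₂ t → ℝ)
    (x : S × Hist A₁ Z₁ (t + 1) × Hist A₂ Z₂ (t + 1)) : ℝ :=
  ∑ s : S, (G.trans s (x.2.1 (Fin.last t)).1 (x.2.2 (Fin.last t)).1).1
      (x.1, (x.2.1 (Fin.last t)).2, (x.2.2 (Fin.last t)).2) *
    f (s, Fin.init x.2.1, Fin.init x.2.2)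

/-- The expected instant reward `k` steps after time `t` as a function of realization plans. -/
def planReward : ℕ → (t : ℕ) → (S × Hist A₁ Z₁ t × Hist A₂ Z₂ t → ℝ) →
    (∀ n, Hist A₁ Z₁ n → A₁ → ℝ) → (∀ n, Hist A₂ Z₂ n → A₂ → ℝ) → ℝ
  | 0, t, f, x, y => ∑ s : S, ∑ θ₁ : Hist A₁ Z₁ t, ∑ θ₂ : Hist A₂ Z₂ t, f (s, θ₁, θ₂) *
      ∑ a₁ : A₁, ∑ a₂ : A₂, x t θ₁ a₁ * y t θ₂ a₂ * G.reward s a₁ a₂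
  | k + 1, t, f, x, y => planReward k (t + 1) (G.chanceStep f) x y

/-- The payoff of a pair of realization plans in the subgame at `o`. -/
def planValue (t : ℕ) (o : Occupancy S A₁ A₂ Z₁ Z₂ t) (x : ∀ n, Hist A₁ Z₁ n → A₁ → ℝ)
    (y : ∀ n, Hist A₂ Z₂ n → A₂ → ℝ) : ℝ :=
  ∑ k ∈ Finset.range (G.horizon - t), G.discount ^ k * G.planReward k t o.1 x y

/-- The occupancy state factors into a chance weight `f` and one reach weight per player. A
transition preserves this form: `chanceStep` updates `f`, and each decision rule extends its own
player's weight. The start `t₀` stays fixed while `t` advances. -/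
theorem expReward_eq_planReward {t₀ : ℕ} (σ₁ : Strategy A₁ Z₁) (σ₂ : Strategy A₂ Z₂) (k : ℕ) :
    ∀ {t : ℕ} (_ : t₀ ≤ t) (o : Occupancy S A₁ A₂ Z₁ Z₂ t)
      (f : S × Hist A₁ Z₁ t × Hist A₂ Z₂ t → ℝ)
      (_ : ∀ s θ₁ θ₂, o.1 (s, θ₁, θ₂) =
        f (s, θ₁, θ₂) * reachWeight t₀ σ₁ t θ₁ * reachWeight t₀ σ₂ t θ₂),
      G.expReward k t o σ₁ σ₂ =
        G.planReward k t f (realizationPlan t₀ σ₁) (realizationPlan t₀ σ₂) := by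
  induction k with
  | zero =>
    intro t _ o f hf
    simp only [expReward, planReward, occReward, realizationPlan, hf, Finset.mul_sum]
    refine Finset.sum_congr rfl fun s _ => Finset.sum_congr rfl fun θ₁ _ =>
      Finset.sum_congr rfl fun θ₂ _ => Finset.sum_congr rfl fun a₁ _ =>
      Finset.sum_congr rfl fun a₂ _ => ?_
    ring
  | succ k ih =>
    intro t ht o f hf
    refine ih (Nat.le_succ_of_le ht) _ _ fun s θ₁ θ₂ => ?_
    rw [reachWeight_succ _ _ ht, reachWeight_succ _ _ ht]
    simp only [next, nextFun, chanceStep, hf, Finset.mul_sum, Finset.sum_mul]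
    refine Finset.sum_congr rfl fun s _ => ?_
    ring

theorem value_eq_planValue (t : ℕ) (o : Occupancy S A₁ A₂ Z₁ Z₂ t) (σ₁ : Strategy A₁ Z₁)
    (σ₂ : Strategy A₂ Z₂) :
    G.value t o σ₁ σ₂ = G.planValue t o (realizationPlan t σ₁) (realizationPlan t σ₂) := by
  refine Finset.sum_congr rfl fun k _ => ?_
  rw [G.expReward_eq_planReward σ₁ σ₂ k le_rfl o o.1 fun s θ₁ θ₂ => ?_]
  rw [reachWeight_of_le t σ₁ le_rfl, reachWeight_of_le t σ₂ le_rfl, mul_one, mul_one]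

/-- Only the plan entries at the time of the reward occur, one factor per player, because they
already contain all earlier action probabilities of that player. -/
theorem isLinearMap_planReward_left (k : ℕ) : ∀ (t : ℕ)
    (f : S × Hist A₁ Z₁ t × Hist A₂ Z₂ t → ℝ) (y : ∀ n, Hist A₂ Z₂ n → A₂ → ℝ),
    IsLinearMap ℝ fun x => G.planReward k t f x y := by
  induction k with
  | zero =>
    refine fun t f y => ⟨fun x x' => ?_, fun c x => ?_⟩
    · simp only [planReward, Pi.add_apply, add_mul, mul_add, Finset.sum_add_distrib]
    · simp only [planReward, Pi.smul_apply, smul_eq_mul, Finset.mul_sum]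
      refine Finset.sum_congr rfl fun s _ => Finset.sum_congr rfl fun θ₁ _ =>
        Finset.sum_congr rfl fun θ₂ _ => Finset.sum_congr rfl fun a₁ _ =>
        Finset.sum_congr rfl fun a₂ _ => ?_
      ring
  | succ k ih => exact fun t f y => ih (t + 1) _ y

theorem isLinearMap_planReward_right (k : ℕ) : ∀ (t : ℕ)
    (f : S × Hist A₁ Z₁ t × Hist A₂ Z₂ t → ℝ) (x : ∀ n, Hist A₁ Z₁ n → A₁ → ℝ),
    IsLinearMap ℝ fun y => G.planReward k t f x y := by
  induction k with
  | zero =>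
    refine fun t f x => ⟨fun y y' => ?_, fun c y => ?_⟩
    · simp only [planReward, Pi.add_apply, add_mul, mul_add, Finset.sum_add_distrib]
    · simp only [planReward, Pi.smul_apply, smul_eq_mul, Finset.mul_sum]
      refine Finset.sum_congr rfl fun s _ => Finset.sum_congr rfl fun θ₁ _ =>
        Finset.sum_congr rfl fun θ₂ _ => Finset.sum_congr rfl fun a₁ _ =>
        Finset.sum_congr rfl fun a₂ _ => ?_
      ring
  | succ k ih => exact fun t f x => ih (t + 1) _ x

theorem isLinearMap_planValue_left (t : ℕ) (o : Occupancy S A₁ A₂ Z₁ Z₂ t)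
    (y : ∀ n, Hist A₂ Z₂ n → A₂ → ℝ) : IsLinearMap ℝ fun x => G.planValue t o x y := by
  refine ⟨fun x x' => ?_, fun c x => ?_⟩
  · simp only [planValue, (G.isLinearMap_planReward_left _ t o.1 y).map_add, mul_add,
      Finset.sum_add_distrib]
  · simp only [planValue, (G.isLinearMap_planReward_left _ t o.1 y).map_smul, smul_eq_mul,
      Finset.mul_sum, mul_left_comm c]

theorem isLinearMap_planValue_right (t : ℕ) (o : Occupancy S A₁ A₂ Z₁ Z₂ t)
    (x : ∀ n, Hist A₁ Z₁ n → A₁ → ℝ) : IsLinearMap ℝ fun y => G.planValue t o x y := by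
  refine ⟨fun y y' => ?_, fun c y => ?_⟩
  · simp only [planValue, (G.isLinearMap_planReward_right _ t o.1 x).map_add, mul_add,
      Finset.sum_add_distrib]
  · simp only [planValue, (G.isLinearMap_planReward_right _ t o.1 x).map_smul, smul_eq_mul,
      Finset.mul_sum, mul_left_comm c]

theorem continuous_planReward (k : ℕ) : ∀ (t : ℕ) (f : S × Hist A₁ Z₁ t × Hist A₂ Z₂ t → ℝ),
    Continuous fun q : (∀ n, Hist A₁ Z₁ n → A₁ → ℝ) × (∀ n, Hist A₂ Z₂ n → A₂ → ℝ) =>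
      G.planReward k t f q.1 q.2 := by
  induction k with
  | zero =>
    intro t f
    simp only [planReward]
    fun_prop
  | succ k ih => exact fun t f => ih (t + 1) _

theorem continuous_planValue (t : ℕ) (o : Occupancy S A₁ A₂ Z₁ Z₂ t) :
    Continuous fun q : (∀ n, Hist A₁ Z₁ n → A₁ → ℝ) × (∀ n, Hist A₂ Z₂ n → A₂ → ℝ) =>
      G.planValue t o q.1 q.2 := by
  have := fun k => G.continuous_planReward k t o.1
  simp only [planValue]
  fun_prop

/-! ### Equilibria of the subgames -/

theorem exists_isNash_value [Nonempty A₁] [Nonempty A₂] (t : ℕ)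
    (o : Occupancy S A₁ A₂ Z₁ Z₂ t) : ∃ σ₁ σ₂, IsNash (G.value t o) σ₁ σ₂ := by
  -- In Sion's theorem the first variable minimizes, hence the plans of player 2 come first.
  have hc := G.continuous_planValue t o
  obtain ⟨y, hy, x, hx, h⟩ := Sion.exists_isSaddlePointOn
    (X := realizationPlans A₂ Z₂ t) (Y := realizationPlans A₁ Z₁ t)
    (f := fun y x => G.planValue t o x y)
    (realizationPlans_nonempty t) (convex_realizationPlans t) (isCompact_realizationPlans t)
    (fun x _ => (hc.comp (f := fun y => (x, y)) (by fun_prop)).lowerSemicontinuous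
      |>.lowerSemicontinuousOn _)
    (fun x _ => ((G.isLinearMap_planValue_right t o x).mk'.convexOn
      (convex_realizationPlans t)).quasiconvexOn)
    (convex_realizationPlans t) (realizationPlans_nonempty t) (isCompact_realizationPlans t)
    (fun y _ => (hc.comp (f := fun x => (x, y)) (by fun_prop)).upperSemicontinuous
      |>.upperSemicontinuousOn _)
    (fun y _ => ((G.isLinearMap_planValue_left t o y).mk'.concaveOn
      (convex_realizationPlans t)).quasiconcaveOn)
  obtain ⟨σ₁, rfl⟩ := exists_realizationPlan_eq hx
  obtain ⟨σ₂, rfl⟩ := exists_realizationPlan_eq hy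
  refine ⟨σ₁, σ₂, fun σ₁' => ?_, fun σ₂' => ?_⟩
  · simp only [value_eq_planValue]
    exact h _ hy _ (realizationPlan_mem t σ₁')
  · simp only [value_eq_planValue]
    exact h _ (realizationPlan_mem t σ₂') _ hx

/-! ### Continuity of the values -/

theorem continuous_next (t : ℕ) :
    Continuous fun q : Occupancy S A₁ A₂ Z₁ Z₂ t × DecisionRule A₁ Z₁ t × DecisionRule A₂ Z₂ t =>
      G.next q.1 q.2.1 q.2.2 := by
  have h₀ := fun i => Continuous.stdSimplex_apply (continuous_fst : Continuous fun q :
    Occupancy S A₁ A₂ Z₁ Z₂ t × DecisionRule A₁ Z₁ t × DecisionRule A₂ Z₂ t => q.1) i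
  have h₁ := fun θ i => Continuous.stdSimplex_apply (by fun_prop : Continuous fun q :
    Occupancy S A₁ A₂ Z₁ Z₂ t × DecisionRule A₁ Z₁ t × DecisionRule A₂ Z₂ t => q.2.1 θ) i
  have h₂ := fun θ i => Continuous.stdSimplex_apply (by fun_prop : Continuous fun q :
    Occupancy S A₁ A₂ Z₁ Z₂ t × DecisionRule A₁ Z₁ t × DecisionRule A₂ Z₂ t => q.2.2 θ) i
  refine Continuous.subtype_mk (continuous_pi fun x => ?_) _
  exact ((h₁ _ _).mul (h₂ _ _)).mul
    (continuous_finsetSum _ fun s _ => continuous_const.mul (h₀ _))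

theorem continuous_occReward (t : ℕ) :
    Continuous fun q : Occupancy S A₁ A₂ Z₁ Z₂ t × DecisionRule A₁ Z₁ t × DecisionRule A₂ Z₂ t =>
      G.occReward q.1 q.2.1 q.2.2 := by
  have h₀ := fun i => Continuous.stdSimplex_apply (continuous_fst : Continuous fun q :
    Occupancy S A₁ A₂ Z₁ Z₂ t × DecisionRule A₁ Z₁ t × DecisionRule A₂ Z₂ t => q.1) i
  have h₁ := fun θ i => Continuous.stdSimplex_apply (by fun_prop : Continuous fun q :
    Occupancy S A₁ A₂ Z₁ Z₂ t × DecisionRule A₁ Z₁ t × DecisionRule A₂ Z₂ t => q.2.1 θ) i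
  have h₂ := fun θ i => Continuous.stdSimplex_apply (by fun_prop : Continuous fun q :
    Occupancy S A₁ A₂ Z₁ Z₂ t × DecisionRule A₁ Z₁ t × DecisionRule A₂ Z₂ t => q.2.2 θ) i
  exact continuous_finsetSum _ fun s _ => continuous_finsetSum _ fun θ₁ _ =>
    continuous_finsetSum _ fun θ₂ _ => (h₀ _).mul <| continuous_finsetSum _ fun a₁ _ =>
    continuous_finsetSum _ fun a₂ _ => ((h₁ _ _).mul (h₂ _ _)).mul continuous_const

theorem continuous_expReward (k : ℕ) : ∀ t : ℕ,
    Continuous fun q : Occupancy S A₁ A₂ Z₁ Z₂ t × Strategy A₁ Z₁ × Strategy A₂ Z₂ =>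
      G.expReward k t q.1 q.2.1 q.2.2 := by
  induction k with
  | zero =>
    exact fun t => (G.continuous_occReward t).comp
      (f := fun q : Occupancy S A₁ A₂ Z₁ Z₂ t × Strategy A₁ Z₁ × Strategy A₂ Z₂ =>
        (q.1, q.2.1 t, q.2.2 t)) (by fun_prop)
  | succ k ih =>
    intro t
    have hnext := (G.continuous_next t).comp
      (f := fun q : Occupancy S A₁ A₂ Z₁ Z₂ t × Strategy A₁ Z₁ × Strategy A₂ Z₂ =>
        (q.1, q.2.1 t, q.2.2 t)) (by fun_prop)
    exact (ih (t + 1)).comp (hnext.prodMk continuous_snd)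

theorem continuous_value (t : ℕ) :
    Continuous fun q : Occupancy S A₁ A₂ Z₁ Z₂ t × Strategy A₁ Z₁ × Strategy A₂ Z₂ =>
      G.value t q.1 q.2.1 q.2.2 := by
  have := fun k => G.continuous_expReward k t
  simp only [value]
  fun_prop

theorem continuous_optValue [Nonempty A₁] [Nonempty A₂] (t : ℕ) :
    Continuous fun o : Occupancy S A₁ A₂ Z₁ Z₂ t => G.optValue t o :=
  continuous_nashValue (G.continuous_value t) (G.exists_isNash_value t)

theorem continuous_localGame [Nonempty A₁] [Nonempty A₂] {t : ℕ}
    (o : Occupancy S A₁ A₂ Z₁ Z₂ t) :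
    Continuous fun q : DecisionRule A₁ Z₁ t × DecisionRule A₂ Z₂ t => G.localGame o q.1 q.2 := by
  have hr := (G.continuous_occReward t).comp (Continuous.prodMk_right o)
  have hn := (G.continuous_optValue (t + 1)).comp
    ((G.continuous_next t).comp (Continuous.prodMk_right o))
  exact hr.add (continuous_const.mul hn)

/-! ### The local game -/

/-- This allows a strategy to be changed at time `t` without affecting the subgames at `t + 1`. -/
theorem expReward_congr (k : ℕ) : ∀ {t : ℕ} (o : Occupancy S A₁ A₂ Z₁ Z₂ t)
    {σ₁ σ₁' : Strategy A₁ Z₁} {σ₂ σ₂' : Strategy A₂ Z₂} (_ : ∀ n, t ≤ n → σ₁ n = σ₁' n)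
    (_ : ∀ n, t ≤ n → σ₂ n = σ₂' n),
    G.expReward k t o σ₁ σ₂ = G.expReward k t o σ₁' σ₂' := by
  induction k with
  | zero => intro t o _ _ _ _ h₁ h₂; rw [expReward, expReward, h₁ t le_rfl, h₂ t le_rfl]
  | succ k ih =>
    intro t o _ _ _ _ h₁ h₂
    rw [expReward, expReward, h₁ t le_rfl, h₂ t le_rfl]
    exact ih _ (fun n hn => h₁ n (Nat.le_of_succ_le hn)) fun n hn => h₂ n (Nat.le_of_succ_le hn)

theorem value_congr {t : ℕ} (o : Occupancy S A₁ A₂ Z₁ Z₂ t) {σ₁ σ₁' : Strategy A₁ Z₁}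
    {σ₂ σ₂' : Strategy A₂ Z₂} (h₁ : ∀ n, t ≤ n → σ₁ n = σ₁' n) (h₂ : ∀ n, t ≤ n → σ₂ n = σ₂' n) :
    G.value t o σ₁ σ₂ = G.value t o σ₁' σ₂' :=
  Finset.sum_congr rfl fun k _ => by rw [G.expReward_congr k o h₁ h₂]

theorem value_eq_add {t : ℕ} (ht : t < G.horizon) (o : Occupancy S A₁ A₂ Z₁ Z₂ t)
    (σ₁ : Strategy A₁ Z₁) (σ₂ : Strategy A₂ Z₂) :
    G.value t o σ₁ σ₂ = G.occReward o (σ₁ t) (σ₂ t) +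
      G.discount * G.value (t + 1) (G.next o (σ₁ t) (σ₂ t)) σ₁ σ₂ := by
  -- Since `t < G.horizon`, the truncated subtraction leaves a term `k = 0` to split off, the
  -- instant reward.
  rw [value, value, show G.horizon - t = (G.horizon - (t + 1)) + 1 by omega,
    Finset.sum_range_succ', add_comm, Finset.mul_sum]
  simp only [expReward, pow_zero, one_mul, pow_succ', mul_assoc]

theorem value_update_left {t : ℕ} (ht : t < G.horizon) (o : Occupancy S A₁ A₂ Z₁ Z₂ t)
    (β₁ : DecisionRule A₁ Z₁ t) (σ₁ : Strategy A₁ Z₁) (σ₂ : Strategy A₂ Z₂) :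
    G.value t o (Function.update σ₁ t β₁) σ₂ = G.occReward o β₁ (σ₂ t) +
      G.discount * G.value (t + 1) (G.next o β₁ (σ₂ t)) σ₁ σ₂ := by
  rw [G.value_eq_add ht, Function.update_self]
  rw [G.value_congr _ (fun n hn => Function.update_of_ne (by omega) _ _) fun _ _ => rfl]

theorem value_update_right {t : ℕ} (ht : t < G.horizon) (o : Occupancy S A₁ A₂ Z₁ Z₂ t)
    (β₂ : DecisionRule A₂ Z₂ t) (σ₁ : Strategy A₁ Z₁) (σ₂ : Strategy A₂ Z₂) :
    G.value t o σ₁ (Function.update σ₂ t β₂) = G.occReward o (σ₁ t) β₂ +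
      G.discount * G.value (t + 1) (G.next o (σ₁ t) β₂) σ₁ σ₂ := by
  rw [G.value_eq_add ht, Function.update_self]
  rw [G.value_congr _ (fun _ _ => rfl) fun n hn => Function.update_of_ne (by omega) _ _]

/-- The first decision rules of an equilibrium of a subgame are an equilibrium of the local
game. -/
theorem isNash_localGame [Nonempty A₁] [Nonempty A₂] {t : ℕ} (ht : t < G.horizon)
    (o : Occupancy S A₁ A₂ Z₁ Z₂ t) {σ₁ : Strategy A₁ Z₁} {σ₂ : Strategy A₂ Z₂}
    (h : IsNash (G.value t o) σ₁ σ₂) : IsNash (G.localGame o) (σ₁ t) (σ₂ t) := by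
  have hle : ∀ β₁, G.localGame o β₁ (σ₂ t) ≤ G.value t o σ₁ σ₂ := by
    intro β₁
    obtain ⟨ρ₁, ρ₂, hρ⟩ := G.exists_isNash_value (t + 1) (G.next o β₁ (σ₂ t))
    -- After `β₁`, the strategy `ρ₁` secures the value of the subgame reached against every
    -- continuation, in particular against `σ₂`.
    refine le_trans ?_ (h.1 (Function.update ρ₁ t β₁))
    rw [G.value_update_left ht, localGame, optValue, hρ.nashValue_eq]
    gcongr
    · exact G.discount_nonneg
    · exact hρ.2 σ₂
  have hge : ∀ β₂, G.value t o σ₁ σ₂ ≤ G.localGame o (σ₁ t) β₂ := by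
    intro β₂
    obtain ⟨ρ₁, ρ₂, hρ⟩ := G.exists_isNash_value (t + 1) (G.next o (σ₁ t) β₂)
    refine (h.2 (Function.update ρ₂ t β₂)).trans ?_
    rw [G.value_update_right ht, localGame, optValue, hρ.nashValue_eq]
    gcongr
    · exact G.discount_nonneg
    · exact hρ.1 σ₁
  -- At `(σ₁ t, σ₂ t)` the two bounds meet, so the local payoff there is the equilibrium value of
  -- the subgame.
  exact ⟨fun β₁ => (hle β₁).trans (hge _), fun β₂ => (hle _).trans (hge β₂)⟩

end ZSPOSG

theorem mainTheorem2 {S A₁ A₂ Z₁ Z₂ : Type*} [Fintype S] [Fintype A₁] [Fintype A₂] [Fintype Z₁]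
    [Fintype Z₂] [Nonempty A₁] [Nonempty A₂] (G : ZSPOSG S A₁ A₂ Z₁ Z₂) (τ : ℕ)
    (hτ : τ < G.horizon) (o : Occupancy S A₁ A₂ Z₁ Z₂ τ) :
    -- the subgames that define the local game have equilibria, with value `optValue`
    (∀ o' : Occupancy S A₁ A₂ Z₁ Z₂ (τ + 1),
      (∃ σ₁ σ₂, IsNash (G.value (τ + 1) o') σ₁ σ₂) ∧
      ∀ σ₁ σ₂, IsNash (G.value (τ + 1) o') σ₁ σ₂ →
        G.value (τ + 1) o' σ₁ σ₂ = G.optValue (τ + 1) o') ∧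
    -- the local game has a Nash equilibrium
    (∃ β₁ β₂, IsNash (G.localGame o) β₁ β₂) ∧
    -- all its Nash equilibria have the same value
    (∀ β₁ β₂ β₁' β₂', IsNash (G.localGame o) β₁ β₂ → IsNash (G.localGame o) β₁' β₂' →
      G.localGame o β₁ β₂ = G.localGame o β₁' β₂') ∧
    -- the maximin and minimax problems have solutions, and solving them yields an equilibrium
    (∃ β₁ v, SolvesMaximin (G.localGame o) β₁ v) ∧
    (∃ β₂ w, SolvesMinimax (G.localGame o) β₂ w) ∧
    (∀ β₁ v β₂ w, SolvesMaximin (G.localGame o) β₁ v → SolvesMinimax (G.localGame o) β₂ w →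
      v = w ∧ IsNash (G.localGame o) β₁ β₂ ∧ G.localGame o β₁ β₂ = v) := by
  -- The equilibrium is taken in the subgame at `τ` itself; the subgames at `τ + 1` enter only
  -- through `optValue`.
  obtain ⟨σ₁, σ₂, hσ⟩ := G.exists_isNash_value τ o
  have hN := G.isNash_localGame hτ o hσ
  have hc := G.continuous_localGame o
  have hmin : ∀ β₁, ∃ m, IsLeast (Set.range (G.localGame o β₁)) m := fun β₁ =>
    (isCompact_range (hc.comp (Continuous.prodMk_right β₁))).exists_isLeast (Set.range_nonempty _)
  have hmax : ∀ β₂, ∃ m, IsGreatest (Set.range fun β₁ => G.localGame o β₁ β₂) m := fun β₂ =>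
    (isCompact_range (hc.comp (Continuous.prodMk_left β₂))).exists_isGreatest
      (Set.range_nonempty _)
  exact ⟨fun o' => ⟨G.exists_isNash_value (τ + 1) o', fun _ _ h => h.nashValue_eq.symm⟩,
    ⟨_, _, hN⟩, fun _ _ _ _ h h' => h.value_unique h', ⟨_, _, hN.solvesMaximin hmin⟩,
    ⟨_, _, hN.solvesMinimax hmax⟩, fun _ _ _ _ hx hy => hx.isNash hy hN⟩
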